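/- Let $A$ be a commutative Noetherian ring, $M$ a finitely generated $A$-module and $I\subseteq A$ an ideal with $IM\neq M$. An $M$-regular sequence in $I$ is a finite (possibly empty) sequence $a_1,\dots,a_r$ of elements of $I$ such that, for each $i$, multiplication by $a_i$ is injective on $M/\langle a_1,\dots,a_{i-1}\rangle M$; it is maximal if no $a\in I$ makes $a_1,\dots,a_r,a$ an $M$-regular sequence. For a closed subset $Z$ of a topological space $X$ and a sheaf of abelian groups $\mathscr{F}$ on $X$, put $\Gamma_Z(X,\mathscr{F})=\ker\big(\mathscr{F}(X)\to\mathscr{F}(X\setminus Z)\big)$, let $H^p_Z(X,-)$ be the right derived functors of $\Gamma_Z(X,-)$ from sheaves of abelian groups on $X$ to abelian groups, and let $H^p_I(M)=H^p_{V(I)}(\operatorname{Spec}A,\tilde M)$ be the local cohomology groups of $M$ with respect to $I$, where $\tilde M$ is the quasi-coherent sheaf on $\operatorname{Spec} A$ associated to $M$. Then maximal $M$-regular sequences in $I$ exist and all have the same length; this common length, which is also the supremum of the lengths of all $M$-regular sequences in $I$, is denoted $\operatorname{depth}_I M$. For every integer $n\ge 0$, $$\operatorname{depth}_I M\ge n\quad\Longleftrightarrow\quad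 H^p_I(M)=0\ \text{ for all } 0\le p<n .$$ -/

import Mathlib

open CategoryTheory TopologicalSpace Opposite

universe u

noncomputable section

namespace TopCat.Sheaf

variable {X : TopCat.{u}}

/-- The group `Γ_Z(X, F) = ker (F(X) → F(X ∖ Z))` of sections of the sheaf of abelian groups `F`
with support in the closed subset `Z`. -/
def sectionsWithSupport (Z : Closeds X) (F : TopCat.Sheaf AddCommGrpCat.{u} X) :
    AddSubgroup (F.obj.obj (op ⊤)) :=
  (F.obj.map (homOfLE (le_top : Z.compl ≤ ⊤)).op).hom.ker

lemma map_mem_sectionsWithSupport (Z : Closeds X) {F G : TopCat.Sheaf AddCommGrpCat.{u} X}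
    (f : F ⟶ G) (s : F.obj.obj (op ⊤)) (hs : s ∈ sectionsWithSupport Z F) :
    (f.hom.app (op ⊤)).hom s ∈ sectionsWithSupport Z G := by
  have h := ConcreteCategory.congr_hom
    (f.hom.naturality (homOfLE (le_top : Z.compl ≤ ⊤)).op) s
  have hs' : F.obj.map (homOfLE (le_top : Z.compl ≤ ⊤)).op s = 0 := hs
  change G.obj.map (homOfLE (le_top : Z.compl ≤ ⊤)).op (f.hom.app (op ⊤) s) = 0
  simp only [ConcreteCategory.comp_apply] at h
  rw [← h, hs', map_zero]

/-- The functor `Γ_Z(X, -)` from sheaves of abelian groups on `X` to abelian groups. -/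
def ΓSupport (Z : Closeds X) : TopCat.Sheaf AddCommGrpCat.{u} X ⥤ AddCommGrpCat.{u} where
  obj F := AddCommGrpCat.of (sectionsWithSupport Z F)
  map {F G} f := AddCommGrpCat.ofHom
    (((f.hom.app (op ⊤)).hom.comp (sectionsWithSupport Z F).subtype).codRestrict
      (sectionsWithSupport Z G) fun s => map_mem_sectionsWithSupport Z f s.1 s.2)
  map_id _ := rfl
  map_comp _ _ := rfl

instance (Z : Closeds X) : (ΓSupport Z).Additive where
  map_add := rfl

/-- The cohomology groups `H^p_Z(X, -)` with support in the closed subset `Z`: the right derived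
functors of `Γ_Z(X, -)` on the category of sheaves of abelian groups. -/
def cohomologyWithSupport (Z : Closeds X) (p : ℕ) :
    TopCat.Sheaf AddCommGrpCat.{u} X ⥤ AddCommGrpCat.{u} :=
  (ΓSupport Z).rightDerived p

end TopCat.Sheaf

section LocalCohomology

variable {A : Type u} [CommRing A] (I : Ideal A) (M : Type u) [AddCommGroup M] [Module A M]

/-- The sheaf of abelian groups on `Spec A` underlying the quasi-coherent sheaf attached to the
`A`-module `M`. -/
def tildeAbSheaf :
    TopCat.Sheaf AddCommGrpCat.{u} (AlgebraicGeometry.Spec (CommRingCat.of A)).toTopCat where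
  obj := (AlgebraicGeometry.tilde (R := CommRingCat.of A) (ModuleCat.of A M)).presheaf
  property := (AlgebraicGeometry.tilde (R := CommRingCat.of A) (ModuleCat.of A M)).isSheaf

/-- The closed subset `V(I)` of `Spec A`. -/
def closedZeroLocus : Closeds (AlgebraicGeometry.Spec (CommRingCat.of A)).toTopCat where
  carrier := PrimeSpectrum.zeroLocus (I : Set A)
  isClosed' := PrimeSpectrum.isClosed_zeroLocus (I : Set A)

/-- The local cohomology group `H^p_I(M) = H^p_{V(I)}(Spec A, M^~)`. -/
def sheafLocalCohomology (p : ℕ) : AddCommGrpCat.{u} :=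
  (TopCat.Sheaf.cohomologyWithSupport (closedZeroLocus I) p).obj (tildeAbSheaf M (A := A))

end LocalCohomology

section Depth

variable {A : Type*} [CommRing A] (I : Ideal A) (M : Type*) [AddCommGroup M] [Module A M]

/-- `a₁, …, aₙ` is an `M`-regular sequence in `I`: each `aᵢ` lies in `I` and is not a zero-divisor
on `M ⧸ (a₁, …, aᵢ₋₁) M`. -/
def IsRegularSeqIn (rs : List A) : Prop :=
  (∀ a ∈ rs, a ∈ I) ∧ RingTheory.Sequence.IsWeaklyRegular M rs

/-- An `M`-regular sequence in `I` which cannot be prolonged to a longer one. -/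
def IsMaximalRegularSeqIn (rs : List A) : Prop :=
  IsRegularSeqIn I M rs ∧ ∀ a, ¬ IsRegularSeqIn I M (rs ++ [a])

/-- The depth of `M` with respect to `I`: the supremum of the lengths of the `M`-regular
sequences in `I`. -/
def depth : ℕ∞ :=
  ⨆ (rs : List A) (_ : IsRegularSeqIn I M rs), (rs.length : ℕ∞)

end Depth

end

/-!
The functor `Γ_Z` is corepresented by the sheaf `ℤ_Z`, so that `H^p_I(M) = Ext^p(ℤ_Z, M^~)` for
`Z = V(I)`. If `J` is an injective module over a noetherian ring, then `J^~` is flasque by the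
Artin-Rees lemma, so `Ext^p(ℤ_Z, J^~) = 0` for `p > 0`; embedding `M` into injectives, dimension
shifting from the case `p = 0` shows that every element of `H^p_I(M)` is killed by a power of each
`a ∈ I`. For an `M`-regular `a ∈ I`, the long exact sequence of `0 → M → M → M/aM → 0` therefore
shows that `H^p_I(M) = 0` for all `p ≤ n` if and only if `H^p_I(M/aM) = 0` for all `p < n`.
The induction starts because `I` contains an `M`-regular element as soon as `H^0_I(M) = 0`: the
latter means that no nonzero element of `M` is killed by `I`.
-/

noncomputable section

open CategoryTheory.Limits CategoryTheory.Abelian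

section RightDerived

universe v w

variable {C : Type u} [Category.{v} C] [Abelian C] [HasInjectiveResolutions C]
  {T : C ⥤ AddCommGrpCat.{v}} [T.Additive] {K : C}

lemma isZero_rightDerived_zero_obj_iff_subsingleton_hom
    (e : T ≅ preadditiveCoyoneda.obj (op K)) (F : C) :
    IsZero ((T.rightDerived 0).obj F) ↔ Subsingleton (K ⟶ F) := by
  have := preservesFiniteLimits_of_natIso e.symm
  rw [((T.rightDerivedZeroIsoSelf ≪≫ e).app F).isZero_iff, AddCommGrpCat.isZero_iff_subsingleton]
  rfl

variable [HasExt.{w} C]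

lemma isZero_rightDerived_succ_obj_iff_subsingleton_ext
    (e : T ≅ preadditiveCoyoneda.obj (op K)) (F : C) (p : ℕ) :
    IsZero ((T.rightDerived (p + 1)).obj F) ↔ Subsingleton (Ext K F (p + 1)) := by
  let R := injectiveResolution F
  let eR := (NatIso.mapHomologicalComplex e (ComplexShape.up ℕ)).app R.cocomplex
  have isZero_iff_exact : IsZero ((T.rightDerived (p + 1)).obj F) ↔
      ∀ f : K ⟶ R.cocomplex.X (p + 1), f ≫ R.cocomplex.d (p + 1) (p + 2) = 0 →
        ∃ g, g ≫ R.cocomplex.d p (p + 1) = f := by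
    rw [(R.isoRightDerivedObj T (p + 1) ≪≫
        (HomologicalComplex.homologyFunctor _ _ (p + 1)).mapIso eR).isZero_iff,
      HomologicalComplex.homologyFunctor_obj, ← HomologicalComplex.exactAt_iff_isZero_homology,
      HomologicalComplex.exactAt_iff' _ p (p + 1) (p + 2) (by simp) (by simp),
      ShortComplex.ab_exact_iff]
    rfl
  rw [isZero_iff_exact]
  constructor
  · refine fun h => subsingleton_of_forall_eq 0 fun x => ?_
    obtain ⟨f, hf, rfl⟩ := R.extMk_surjective x (p + 2) rfl
    exact (R.extMk_eq_zero_iff f _ rfl hf p rfl).2 (h f hf)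
  · exact fun h f hf => (R.extMk_eq_zero_iff f _ rfl hf p rfl).1 (h.elim _ _)

lemma isZero_rightDerived_obj_iff_subsingleton_ext
    (e : T ≅ preadditiveCoyoneda.obj (op K)) (F : C) :
    ∀ p : ℕ, IsZero ((T.rightDerived p).obj F) ↔ Subsingleton (Ext K F p)
  | 0 => (isZero_rightDerived_zero_obj_iff_subsingleton_hom e F).trans
      Ext.homEquiv₀.subsingleton_congr.symm
  | p + 1 => isZero_rightDerived_succ_obj_iff_subsingleton_ext e F p

end RightDerived

section Sheaf

open TopCat TopCat.Sheaf

variable {X : TopCat.{u}}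

lemma sheafHom_naturality_apply {F G : X.Sheaf AddCommGrpCat.{u}} (f : F ⟶ G)
    {U V : (Opens X)ᵒᵖ} (i : U ⟶ V) (s : F.obj.obj U) :
    f.hom.app V (F.obj.map i s) = G.obj.map i (f.hom.app U s) :=
  ConcreteCategory.congr_hom (f.hom.naturality i) s

lemma sheaf_exact_of_locally_lift (S : ShortComplex (X.Sheaf AddCommGrpCat.{u}))
    (h : ∀ (U : Opens X) (s : S.X₂.obj.obj (op U)), S.g.hom.app (op U) s = 0 → ∀ x ∈ U,
      ∃ (V : Opens X) (i : V ⟶ U) (_ : x ∈ V) (t : S.X₁.obj.obj (op V)),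
        S.f.hom.app (op V) t = S.X₂.obj.map i.op s) :
    S.Exact := by
  rw [exact_iff_stalkFunctor_map_exact]
  intro x
  rw [ShortComplex.ab_exact_iff]
  intro y (hy : (Presheaf.stalkFunctor AddCommGrpCat x).map S.g.hom y = 0)
  obtain ⟨U, hxU, s, rfl⟩ := Presheaf.exists_germ_eq S.X₂.obj y
  rw [Presheaf.stalkFunctor_map_germ_apply] at hy
  obtain ⟨W, hxW, i, j, hij⟩ := Presheaf.germ_eq S.X₃.obj x hxU hxU _ _
    (hy.trans (map_zero (Presheaf.germ S.X₃.obj U x hxU).hom).symm)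
  have hs : S.g.hom.app (op W) (S.X₂.obj.map i.op s) = 0 :=
    (sheafHom_naturality_apply S.g i.op s).trans (hij.trans (map_zero _))
  obtain ⟨V, k, hxV, t, ht⟩ := h W (S.X₂.obj.map i.op s) hs x hxW
  refine ⟨Presheaf.germ S.X₁.obj V x hxV t,
    (Presheaf.stalkFunctor_map_germ_apply V x hxV S.f.hom t).trans ?_⟩
  rw [ht, Presheaf.germ_res_apply, Presheaf.germ_res_apply]

variable (X) in
/-- The functor sending an open subset `U` to the sheaf `ℤ_U`: the constant sheaf `ℤ` on `U`
extended by zero, encoded as the sheafification of the free abelian presheaf on `U`. -/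
def freeOpen : Opens X ⥤ X.Sheaf AddCommGrpCat.{u} :=
  yoneda ⋙ (Functor.whiskeringRight (Opens X)ᵒᵖ _ _).obj AddCommGrpCat.free.{u} ⋙
    presheafToSheaf (Opens.grothendieckTopology X) AddCommGrpCat.{u}

instance {U V : Opens X} (i : V ⟶ U) : Mono ((freeOpen X).map i) :=
  inferInstanceAs (Mono ((presheafToSheaf (Opens.grothendieckTopology X) AddCommGrpCat.{u}).map
    (Functor.whiskerRight (yoneda.map i) AddCommGrpCat.free)))

namespace freeOpen

variable (X) in
/-- The free abelian sheaf functor is left adjoint to the forgetful functor from abelian sheaves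
to presheaves of types. -/
def adjunction :
    (Functor.whiskeringRight (Opens X)ᵒᵖ _ _).obj AddCommGrpCat.free.{u} ⋙
      presheafToSheaf (Opens.grothendieckTopology X) AddCommGrpCat.{u} ⊣
    sheafToPresheaf (Opens.grothendieckTopology X) AddCommGrpCat.{u} ⋙
      (Functor.whiskeringRight (Opens X)ᵒᵖ _ _).obj (CategoryTheory.forget AddCommGrpCat.{u}) :=
  (AddCommGrpCat.adj.whiskerRight _).comp (sheafificationAdjunction _ _)

/-- Morphisms `ℤ_U ⟶ F` are the sections of `F` over `U`. -/
def homEquiv (U : Opens X) (F : X.Sheaf AddCommGrpCat.{u}) :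
    ((freeOpen X).obj U ⟶ F) ≃ F.obj.obj (op U) :=
  ((adjunction X).homEquiv (yoneda.obj U) F).trans yonedaEquiv

lemma homEquiv_comp {U : Opens X} {F G : X.Sheaf AddCommGrpCat.{u}}
    (f : (freeOpen X).obj U ⟶ F) (g : F ⟶ G) :
    homEquiv U G (f ≫ g) = g.hom.app (op U) (homEquiv U F f) :=
  (congr_arg yonedaEquiv ((adjunction X).homEquiv_naturality_right f g)).trans
    (yonedaEquiv_comp _ _)

lemma homEquiv_map_comp {U V : Opens X} (i : V ⟶ U) {F : X.Sheaf AddCommGrpCat.{u}}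
    (f : (freeOpen X).obj U ⟶ F) :
    homEquiv V F ((freeOpen X).map i ≫ f) = F.obj.map i.op (homEquiv U F f) :=
  (congr_arg yonedaEquiv ((adjunction X).homEquiv_naturality_left (yoneda.map i) f)).trans
    (yonedaEquiv_naturality _ i).symm

lemma homEquiv_add {U : Opens X} {F : X.Sheaf AddCommGrpCat.{u}} (f g : (freeOpen X).obj U ⟶ F) :
    homEquiv U F (f + g) = homEquiv U F f + homEquiv U F g := by
  have homEquiv_eq (f : (freeOpen X).obj U ⟶ F) :
      homEquiv U F f = f.hom.app (op U) (homEquiv U _ (𝟙 _)) := by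
    rw [← homEquiv_comp, Category.id_comp]
  rw [homEquiv_eq, homEquiv_eq f, homEquiv_eq g]
  rfl

lemma homEquiv_zero (U : Opens X) (F : X.Sheaf AddCommGrpCat.{u}) : homEquiv U F 0 = 0 := by
  simpa only [add_zero, left_eq_add] using homEquiv_add (0 : (freeOpen X).obj U ⟶ F) 0

lemma homEquiv_mem_sectionsWithSupport_iff {Z : Closeds X} {F : X.Sheaf AddCommGrpCat.{u}}
    (f : (freeOpen X).obj ⊤ ⟶ F) :
    homEquiv ⊤ F f ∈ sectionsWithSupport Z F ↔
      (freeOpen X).map (homOfLE (le_top : Z.compl ≤ ⊤)) ≫ f = 0 := by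
  rw [← (homEquiv _ F).apply_eq_iff_eq, homEquiv_map_comp, homEquiv_zero]
  rfl

end freeOpen

lemma isFlasque_of_injective (E : X.Sheaf AddCommGrpCat.{u}) [Injective E] : IsFlasque E where
  epi {U V} i := by
    refine (AddCommGrpCat.epi_iff_surjective _).2 fun s => ?_
    obtain ⟨f, rfl⟩ := (freeOpen.homEquiv V.unop E).surjective s
    refine ⟨freeOpen.homEquiv U.unop E (Injective.factorThru f ((freeOpen X).map i.unop)),
      (freeOpen.homEquiv_map_comp i.unop _).symm.trans ?_⟩
    rw [Injective.comp_factorThru]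

lemma exists_shortExact_injective_isFlasque (F : X.Sheaf AddCommGrpCat.{u}) [IsFlasque F] :
    ∃ (E Q : X.Sheaf AddCommGrpCat.{u}) (f : F ⟶ E) (g : E ⟶ Q) (w : f ≫ g = 0),
      (ShortComplex.mk f g w).ShortExact ∧ Injective E ∧ IsFlasque Q := by
  let S := ShortComplex.mk (Injective.ι F) (cokernel.π (Injective.ι F)) (cokernel.condition _)
  have hS : S.ShortExact := { exact := ShortComplex.exact_cokernel _ }
  have : IsFlasque S.X₁ := ‹_›
  have : IsFlasque S.X₂ := isFlasque_of_injective (Injective.under F)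
  exact ⟨_, _, _, _, _, hS, inferInstance, IsFlasque.of_shortExact_of_isFlasque₁₂ hS⟩

lemma exists_mem_sectionsWithSupport_app_eq {Z : Closeds X}
    {S : ShortComplex (X.Sheaf AddCommGrpCat.{u})} (hS : S.ShortExact) [IsFlasque S.X₁]
    {s : S.X₃.obj.obj (op ⊤)} (hs : s ∈ sectionsWithSupport Z S.X₃) :
    ∃ t ∈ sectionsWithSupport Z S.X₂, S.g.hom.app (op ⊤) t = s := by
  let i : op (⊤ : Opens X) ⟶ op Z.compl := (homOfLE (le_top : Z.compl ≤ ⊤)).op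
  obtain ⟨t, rfl⟩ := (AddCommGrpCat.epi_iff_surjective _).1
    (IsFlasque.epi_of_shortExact (U := ⊤) hS) s
  obtain ⟨r, hr⟩ := sections_exact_of_left_exact hS.exact hS.mono_f (S.X₂.obj.map i t)
    ((sheafHom_naturality_apply S.g i t).trans hs)
  obtain ⟨r', rfl⟩ := (AddCommGrpCat.epi_iff_surjective (S.X₁.obj.map i)).1
    (Presheaf.IsFlasque.epi i) r
  refine ⟨t - S.f.hom.app (op ⊤) r', ?_, ?_⟩
  · change S.X₂.obj.map i (t - S.f.hom.app (op ⊤) r') = 0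
    rw [map_sub, ← sheafHom_naturality_apply, hr, sub_self]
  · have hfg : S.g.hom.app (op ⊤) (S.f.hom.app (op ⊤) r') = 0 :=
      congr_arg (fun φ => φ.hom.app (op ⊤) r') S.zero
    rw [map_sub, hfg, sub_zero]

/-- The sheaf `ℤ_Z = ℤ_X / ℤ_{X ∖ Z}`: the constant sheaf `ℤ` on the closed subset `Z`, extended
by zero. -/
def freeClosed (Z : Closeds X) : X.Sheaf AddCommGrpCat.{u} :=
  cokernel ((freeOpen X).map (homOfLE (le_top : Z.compl ≤ ⊤)))

namespace freeClosed

variable (Z : Closeds X)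

/-- The quotient map `ℤ_X ⟶ ℤ_Z`. -/
def π : (freeOpen X).obj ⊤ ⟶ freeClosed Z :=
  cokernel.π _

instance : Epi (π Z) :=
  inferInstanceAs (Epi (cokernel.π _))

lemma map_comp_π : (freeOpen X).map (homOfLE (le_top : Z.compl ≤ ⊤)) ≫ π Z = 0 :=
  cokernel.condition _

/-- Morphisms `ℤ_Z ⟶ F` are the sections of `F` with support in `Z`. -/
def homEquiv (F : X.Sheaf AddCommGrpCat.{u}) :
    (freeClosed Z ⟶ F) ≃+ sectionsWithSupport Z F where
  toFun f := ⟨freeOpen.homEquiv ⊤ F (π Z ≫ f), by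
    rw [freeOpen.homEquiv_mem_sectionsWithSupport_iff, ← Category.assoc, map_comp_π, zero_comp]⟩
  invFun s := cokernel.desc _ ((freeOpen.homEquiv ⊤ F).symm s) (by
    rw [← freeOpen.homEquiv_mem_sectionsWithSupport_iff, Equiv.apply_symm_apply]
    exact s.2)
  left_inv f := (cancel_epi (π Z)).1
    ((cokernel.π_desc _ _ _).trans (Equiv.symm_apply_apply _ _))
  right_inv s := Subtype.ext
    ((congr_arg (freeOpen.homEquiv ⊤ F) (cokernel.π_desc _ _ _)).trans
      (Equiv.apply_symm_apply _ _))
  map_add' f g := Subtype.ext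
    ((congr_arg (freeOpen.homEquiv ⊤ F) (Preadditive.comp_add _ _ _ _ _ _)).trans
      (freeOpen.homEquiv_add _ _))

variable {Z}

lemma homEquiv_comp {F G : X.Sheaf AddCommGrpCat.{u}} (f : freeClosed Z ⟶ F) (g : F ⟶ G) :
    (homEquiv Z G (f ≫ g) : G.obj.obj (op ⊤)) =
      g.hom.app (op ⊤) (homEquiv Z F f : F.obj.obj (op ⊤)) := by
  change freeOpen.homEquiv ⊤ G (π Z ≫ f ≫ g) = _
  rw [← Category.assoc, freeOpen.homEquiv_comp]
  rfl

lemma exists_comp_eq_of_shortExact {S : ShortComplex (X.Sheaf AddCommGrpCat.{u})}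
    (hS : S.ShortExact) [IsFlasque S.X₁] (q : freeClosed Z ⟶ S.X₃) :
    ∃ e : freeClosed Z ⟶ S.X₂, e ≫ S.g = q := by
  obtain ⟨t, htZ, ht⟩ := exists_mem_sectionsWithSupport_app_eq hS (homEquiv Z S.X₃ q).2
  refine ⟨(homEquiv Z S.X₂).symm ⟨t, htZ⟩, (homEquiv Z S.X₃).injective (Subtype.ext ?_)⟩
  rw [homEquiv_comp, AddEquiv.apply_symm_apply, ht]

lemma subsingleton_ext_of_isFlasque (p : ℕ) (F : X.Sheaf AddCommGrpCat.{u}) [IsFlasque F] :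
    Subsingleton (Ext (freeClosed Z) F (p + 1)) := by
  induction p generalizing F with
  | zero =>
    obtain ⟨E, Q, f, g, w, hS, _, _⟩ := exists_shortExact_injective_isFlasque F
    refine subsingleton_of_forall_eq 0 fun x => ?_
    obtain ⟨y, rfl⟩ := Ext.covariant_sequence_exact₁ _ hS x (Ext.eq_zero_of_injective _) rfl
    obtain ⟨q, rfl⟩ := (Ext.mk₀_bijective _ _).surjective y
    have : IsFlasque (ShortComplex.mk f g w).X₁ := ‹IsFlasque F›
    obtain ⟨e, rfl⟩ := exists_comp_eq_of_shortExact hS q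
    rw [← Ext.mk₀_comp_mk₀, Ext.comp_assoc (a₂₃ := 1) _ _ _ _ (by lia) (by lia), hS.comp_extClass,
      Ext.comp_zero]
  | succ p ih =>
    obtain ⟨E, Q, f, g, w, hS, _, _⟩ := exists_shortExact_injective_isFlasque F
    refine subsingleton_of_forall_eq 0 fun x => ?_
    obtain ⟨y, rfl⟩ := Ext.covariant_sequence_exact₁ _ hS x (Ext.eq_zero_of_injective _) rfl
    rw [(ih Q).elim y 0, Ext.zero_comp]

end freeClosed

/-- The functor `Γ_Z(X, -)` is corepresented by `ℤ_Z`. -/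
def ΓSupportIso (Z : Closeds X) :
    ΓSupport Z ≅ preadditiveCoyoneda.obj (op (freeClosed Z)) :=
  (NatIso.ofComponents (fun F => (freeClosed.homEquiv Z F).toAddCommGrpIso) (by
    intro F G g
    ext f
    exact Subtype.ext (freeClosed.homEquiv_comp f g))).symm

lemma isZero_cohomologyWithSupport_iff_subsingleton_ext (Z : Closeds X)
    (F : X.Sheaf AddCommGrpCat.{u}) (p : ℕ) :
    IsZero ((cohomologyWithSupport Z p).obj F) ↔ Subsingleton (Ext (freeClosed Z) F p) :=
  isZero_rightDerived_obj_iff_subsingleton_ext (ΓSupportIso Z) F p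

end Sheaf

section ArtinRees

variable {R : Type*} [CommRing R] [IsNoetherianRing R] {P : Type*} [AddCommGroup P] [Module R P]
  [Module.Finite R P]

lemma exists_span_pow_le_annihilator {t : Set R} {N : Submodule R P}
    (h : ∀ g ∈ t, ∀ x ∈ N, ∃ n : ℕ, g ^ n • x = 0) :
    ∃ c : ℕ, Ideal.span t ^ c ≤ N.annihilator := by
  refine Ideal.exists_pow_le_of_le_radical_of_fg (Ideal.span_le.2 fun g hg => ?_)
    (IsNoetherian.noetherian _)
  obtain ⟨S, rfl⟩ := IsNoetherian.noetherian N
  choose! n hn using fun x (hx : x ∈ S) => h g hg x (Submodule.subset_span hx)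
  refine ⟨S.sup n, (Submodule.mem_annihilator_span _ _).2 fun x => ?_⟩
  rw [← Nat.sub_add_cancel (Finset.le_sup (f := n) x.2), pow_add, mul_smul, hn x x.2, smul_zero]

lemma exists_pow_smul_top_disjoint {I : Ideal R} {N : Submodule R P} {c : ℕ}
    (hc : I ^ c ≤ N.annihilator) : ∃ q : ℕ, Disjoint (I ^ q • ⊤) N := by
  obtain ⟨k, hk⟩ := Ideal.exists_pow_inf_eq_pow_smul I N
  refine ⟨k + c, disjoint_iff_inf_le.2 ?_⟩
  rw [hk _ (by lia), Nat.add_sub_cancel_left, Submodule.smul_le]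
  exact fun r hr n hn => (Submodule.mem_bot R).2 (Submodule.mem_annihilator.1 (hc hr) n hn.2)

end ArtinRees

lemma exists_linearMap_eq_on_pow_smul_of_ker_torsion {R J : Type u} [CommRing R]
    [IsNoetherianRing R] [AddCommGroup J] [Module R J] [Module.Injective R J] {P Q : Type*}
    [AddCommGroup P] [Module R P] [Module.Finite R P] [AddCommGroup Q] [Module R Q]
    (φ : P →ₗ[R] Q) (ψ : P →ₗ[R] J) {t : Set R}
    (h : ∀ g ∈ t, ∀ x ∈ LinearMap.ker φ, ∃ n : ℕ, g ^ n • x = 0) :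
    ∃ (q : ℕ) (e : Q →ₗ[R] J), ∀ x ∈ (Ideal.span t ^ q • ⊤ : Submodule R P), e (φ x) = ψ x := by
  obtain ⟨c, hc⟩ := exists_span_pow_le_annihilator h
  obtain ⟨q, hq⟩ := exists_pow_smul_top_disjoint hc
  let L : Submodule R P := Ideal.span t ^ q • ⊤
  have hL : Function.Injective (φ.domRestrict L) := by
    rwa [← LinearMap.ker_eq_bot, LinearMap.ker_domRestrict, ← Submodule.disjoint_iff_comap_eq_bot]
  obtain ⟨e, he⟩ := Module.Injective.extension_property R J _ _ _ hL (ψ.domRestrict L)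
  exact ⟨q, e, fun x hx => LinearMap.congr_fun he ⟨x, hx⟩⟩

section Tilde

open AlgebraicGeometry

variable {R : CommRingCat.{u}} {M N : ModuleCat.{u} R}

/-- The basic open subset `D(f)` as an open subset of the scheme `Spec R`, whose underlying space is
`PrimeSpectrum R` only up to unfolding. -/
def specBasicOpen (f : R) : (Spec R).Opens := PrimeSpectrum.basicOpen f

variable (M) in
/-- The canonical map from `M` to the sections of `M^~` over `U`. -/
def toTildeSections (U : (Spec R).Opens) : M →ₗ[R] Γ(tilde M, U) :=
  (tilde.toOpen M U).hom

lemma tilde_map_toTildeSections {U V : (Spec R).Opens} (i : V ⟶ U) (m : M) :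
    (tilde M).presheaf.map i.op (toTildeSections M U m) = toTildeSections M V m :=
  ConcreteCategory.congr_hom (tilde.toOpen_res M U V i) m

lemma tildeMap_app_toTildeSections (f : M ⟶ N) (U : (Spec R).Opens) (m : M) :
    (tilde.map f).app U (toTildeSections M U m) = toTildeSections N U (f m) :=
  ConcreteCategory.congr_hom (tilde.toOpen_map_app f U) m

lemma tildeMap_app_smul (f : M ⟶ N) (U : (Spec R).Opens) (a : R) (s : Γ(tilde M, U)) :
    (tilde.map f).app U (a • s) = a • (tilde.map f).app U s :=
  ((modulesSpecToSheaf.map (tilde.map f)).hom.app (op U)).hom.map_smul a s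

lemma tilde_map_map {U V W : (Spec R).Opens} (i : V ⟶ U) (j : W ⟶ V) (k : W ⟶ U)
    (s : Γ(tilde M, U)) :
    (tilde M).presheaf.map j.op ((tilde M).presheaf.map i.op s) =
      (tilde M).presheaf.map k.op s :=
  (ConcreteCategory.congr_hom ((tilde M).presheaf.map_comp i.op j.op) s).symm

lemma toTildeSections_top_bijective : Function.Bijective (toTildeSections M ⊤) :=
  (ConcreteCategory.isIso_iff_bijective (tilde.toOpen M ⊤)).1 inferInstance

instance (f : R) :
    IsLocalizedModule.Away f (toTildeSections M (specBasicOpen f)) :=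
  inferInstanceAs (IsLocalizedModule.Away f (tilde.toOpen M (PrimeSpectrum.basicOpen f)).hom)

lemma exists_pow_smul_eq_toTildeSections_basicOpen {f : R}
    (s : Γ(tilde M, specBasicOpen f)) :
    ∃ (n : ℕ) (m : M), f ^ n • s = toTildeSections M (specBasicOpen f) m := by
  obtain ⟨⟨m, ⟨_, n, rfl⟩⟩, h⟩ :=
    IsLocalizedModule.surj (.powers f) (toTildeSections M (specBasicOpen f)) s
  exact ⟨n, m, h⟩

lemma exists_pow_smul_eq_zero_of_toTildeSections_basicOpen_eq_zero {f : R} {m : M}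
    (h : toTildeSections M (specBasicOpen f) m = 0) : ∃ n : ℕ, f ^ n • m = 0 := by
  obtain ⟨⟨_, n, rfl⟩, h⟩ := (IsLocalizedModule.eq_zero_iff (.powers f) _).1 h
  exact ⟨n, h⟩

lemma tilde_pow_smul_bijective (f : R) (n : ℕ) :
    Function.Bijective fun s : Γ(tilde M, specBasicOpen f) => f ^ n • s :=
  (Module.End.isUnit_iff _).1 (IsLocalizedModule.map_units
    (toTildeSections M (specBasicOpen f)) (⟨f ^ n, n, rfl⟩ : Submonoid.powers f))

variable (R) in
/-- The functor sending an `R`-module `M` to the abelian sheaf on `Spec R` underlying `M^~`. -/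
def tildeAbFunctor : ModuleCat.{u} R ⥤ TopCat.Sheaf AddCommGrpCat.{u} (Spec R).toTopCat where
  obj M := ⟨(tilde M).presheaf, (tilde M).isSheaf⟩
  map f := ⟨(tilde.map f).mapPresheaf⟩
  map_id M := ObjectProperty.hom_ext _
    (congr_arg Scheme.Modules.Hom.mapPresheaf (tilde.map_id (M := M)))
  map_comp f g := ObjectProperty.hom_ext _
    (congr_arg Scheme.Modules.Hom.mapPresheaf (tilde.map_comp f g))

instance : (tildeAbFunctor R).Additive where
  map_add {_ _ f g} := ObjectProperty.hom_ext _
    (congr_arg Scheme.Modules.Hom.mapPresheaf (tilde.map_add f g))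

lemma exists_tildeMap_app_eq_of_app_eq_zero {S : ShortComplex (ModuleCat.{u} R)} (hS : S.Exact)
    {f : R} {s : Γ(tilde S.X₂, specBasicOpen f)} (hs : (tilde.map S.g).app _ s = 0) :
    ∃ t, (tilde.map S.f).app _ t = s := by
  obtain ⟨n, m, hm⟩ := exists_pow_smul_eq_toTildeSections_basicOpen s
  obtain ⟨k, hk⟩ : ∃ k : ℕ, f ^ k • S.g m = 0 := by
    refine exists_pow_smul_eq_zero_of_toTildeSections_basicOpen_eq_zero ?_
    rw [← tildeMap_app_toTildeSections, ← hm, tildeMap_app_smul, hs, smul_zero]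
  obtain ⟨m₁, hm₁⟩ := (ShortComplex.moduleCat_exact_iff S).1 hS (f ^ k • m)
    (by rw [map_smul, hk])
  obtain ⟨t, ht : f ^ (k + n) • t = _⟩ :=
    (tilde_pow_smul_bijective f (k + n)).surjective (toTildeSections S.X₁ _ m₁)
  refine ⟨t, (tilde_pow_smul_bijective f (k + n)).injective ?_⟩
  rw [← tildeMap_app_smul, ht, tildeMap_app_toTildeSections, hm₁, map_smul, ← hm, pow_add, mul_smul]

lemma exact_map_tildeAbFunctor (S : ShortComplex (ModuleCat.{u} R)) (hS : S.Exact) :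
    (S.map (tildeAbFunctor R)).Exact := by
  refine sheaf_exact_of_locally_lift _ fun U s hs x hx => ?_
  obtain ⟨_, ⟨_, ⟨f, rfl⟩, rfl⟩, hxf, hfU : specBasicOpen f ≤ U⟩ :=
    PrimeSpectrum.isBasis_basic_opens.exists_subset_of_mem_open hx U.2
  obtain ⟨t, ht⟩ := exists_tildeMap_app_eq_of_app_eq_zero hS
    (s := (tilde S.X₂).presheaf.map (homOfLE hfU).op s)
    ((sheafHom_naturality_apply ((tildeAbFunctor R).map S.g) (homOfLE hfU).op s).trans
      ((congr_arg _ hs).trans (map_zero _)))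
  exact ⟨_, homOfLE hfU, hxf, t, ht⟩

lemma preservesFiniteLimits_and_preservesFiniteColimits_tildeAbFunctor :
    PreservesFiniteLimits (tildeAbFunctor R) ∧ PreservesFiniteColimits (tildeAbFunctor R) :=
  ((tildeAbFunctor R).exact_tfae.out 1 3 :).1 exact_map_tildeAbFunctor

instance : PreservesFiniteLimits (tildeAbFunctor R) :=
  preservesFiniteLimits_and_preservesFiniteColimits_tildeAbFunctor.1

instance : PreservesFiniteColimits (tildeAbFunctor R) :=
  preservesFiniteLimits_and_preservesFiniteColimits_tildeAbFunctor.2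

lemma tilde_section_ext {U : (Spec R).Opens} {t : Set R} (hU : U = ⨆ g ∈ t, specBasicOpen g)
    {s s' : Γ(tilde M, U)}
    (h : ∀ g ∈ t, ∀ i : specBasicOpen g ⟶ U,
      (tilde M).presheaf.map i.op s = (tilde M).presheaf.map i.op s') : s = s' := by
  refine TopCat.Presheaf.IsSheaf.section_ext (tilde M).isSheaf fun x hx => ?_
  subst hU
  obtain ⟨g, hg, hxg⟩ := by simpa only [Opens.mem_iSup, exists_prop] using hx
  have hgU := le_biSup specBasicOpen hg
  exact ⟨_, hgU, hxg, h g hg (homOfLE hgU)⟩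

lemma eq_iSup_specBasicOpen_of_coe_eq_compl_zeroLocus {U : (Spec R).Opens} {t : Set R}
    (hU : (U : Set (Spec R)) = (PrimeSpectrum.zeroLocus t)ᶜ) : U = ⨆ g ∈ t, specBasicOpen g := by
  ext x
  rw [hU, SetLike.mem_coe]
  simp only [Opens.mem_iSup, exists_prop]
  exact Set.not_subset

lemma exists_finset_eq_iSup_specBasicOpen {U : (Spec R).Opens}
    (hU : IsCompact (U : Set (Spec R))) : ∃ t : Finset R, U = ⨆ g ∈ t, specBasicOpen g := by
  obtain ⟨t, ht⟩ := PrimeSpectrum.isCompact_isOpen_iff.1 ⟨hU, U.2⟩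
  exact ⟨t, eq_iSup_specBasicOpen_of_coe_eq_compl_zeroLocus ht.symm⟩

lemma exists_pow_smul_eq_zero_of_map_basicOpen_mul_eq_zero {f g : R}
    (i : specBasicOpen (f * g) ⟶ specBasicOpen g) {s : Γ(tilde M, specBasicOpen g)}
    (hs : (tilde M).presheaf.map i.op s = 0) : ∃ k : ℕ, f ^ k • s = 0 := by
  obtain ⟨j, m, hm⟩ := exists_pow_smul_eq_toTildeSections_basicOpen s
  obtain ⟨k, hk⟩ : ∃ k : ℕ, (f * g) ^ k • m = 0 := by
    refine exists_pow_smul_eq_zero_of_toTildeSections_basicOpen_eq_zero ?_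
    rw [← tilde_map_toTildeSections i, ← hm, Scheme.Modules.map_smul_Spec, hs, smul_zero]
  refine ⟨k, (tilde_pow_smul_bijective g (k + j)).injective ?_⟩
  rw [smul_comm, pow_add, mul_smul, hm, ← mul_smul, ← mul_pow, ← map_smul, hk, map_zero, smul_zero]

lemma exists_pow_smul_eq_zero_of_map_eq_zero {U : (Spec R).Opens}
    (hU : IsCompact (U : Set (Spec R))) {f : R} (i : specBasicOpen f ⟶ U) {s : Γ(tilde M, U)}
    (hs : (tilde M).presheaf.map i.op s = 0) : ∃ n : ℕ, f ^ n • s = 0 := by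
  obtain ⟨t, ht⟩ := exists_finset_eq_iSup_specBasicOpen hU
  have exists_pow (g : R) (j : specBasicOpen g ⟶ U) :
      ∃ k : ℕ, f ^ k • (tilde M).presheaf.map j.op s = 0 := by
    let jf : specBasicOpen (f * g) ⟶ specBasicOpen f :=
      homOfLE (PrimeSpectrum.basicOpen_mul_le_left f g)
    let jg : specBasicOpen (f * g) ⟶ specBasicOpen g :=
      homOfLE (PrimeSpectrum.basicOpen_mul_le_right f g)
    refine exists_pow_smul_eq_zero_of_map_basicOpen_mul_eq_zero jg ?_
    rw [tilde_map_map j jg (jf ≫ i), ← tilde_map_map i jf, hs, map_zero]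
  choose! k hk using fun g (j : Nonempty (specBasicOpen g ⟶ U)) => exists_pow g j.some
  refine ⟨t.sup k, tilde_section_ext ht fun g hg j => ?_⟩
  rw [Scheme.Modules.map_smul_Spec, ← Nat.sub_add_cancel (Finset.le_sup (f := k) hg), pow_add,
    mul_smul, Subsingleton.elim j (Nonempty.some ⟨j⟩), hk g ⟨j⟩, smul_zero, map_zero]

lemma exists_pow_smul_eq_toTildeSections {U : (Spec R).Opens}
    (hU : IsCompact (U : Set (Spec R))) {f : R} (i : specBasicOpen f ⟶ U) (s : Γ(tilde M, U)) :
    ∃ (n : ℕ) (m : M), f ^ n • s = toTildeSections M U m := by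
  obtain ⟨n, m, hm⟩ := exists_pow_smul_eq_toTildeSections_basicOpen
    ((tilde M).presheaf.map i.op s)
  obtain ⟨k, hk⟩ : ∃ k : ℕ, f ^ k • (f ^ n • s - toTildeSections M U m) = 0 := by
    refine exists_pow_smul_eq_zero_of_map_eq_zero hU i ?_
    rw [map_sub, Scheme.Modules.map_smul_Spec, hm, tilde_map_toTildeSections, sub_self]
  refine ⟨k + n, f ^ k • m, ?_⟩
  rw [pow_add, mul_smul, map_smul, ← sub_eq_zero, ← smul_sub, hk]

lemma smul_eq_toTildeSections_of_mem_span {U : (Spec R).Opens} {s : Γ(tilde M, U)} {t : Set (R × M)}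
    (h : ∀ x ∈ t, x.1 • s = toTildeSections M U x.2) :
    ∀ x ∈ Submodule.span R t, x.1 • s = toTildeSections M U x.2 := by
  let φ := LinearMap.toSpanSingleton R Γ(tilde M, U) s ∘ₗ LinearMap.fst R R M
  let ψ := toTildeSections M U ∘ₗ LinearMap.snd R R M
  exact fun x hx => LinearMap.eqOn_span (f := φ) (g := ψ) h hx

lemma toTildeSections_surjective_of_injective [IsNoetherianRing R] (J : ModuleCat.{u} R)
    [Module.Injective R J] (U : (Spec R).Opens) :
    Function.Surjective (toTildeSections J U) := by
  intro s
  have hUc : IsCompact (U : Set (Spec R)) := NoetherianSpace.isCompact (α := PrimeSpectrum R) _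
  obtain ⟨t, hU⟩ := exists_finset_eq_iSup_specBasicOpen hUc
  let ι (f : R) (hf : f ∈ t) : specBasicOpen f ⟶ U := homOfLE (hU ▸ le_biSup specBasicOpen hf)
  choose! n m hnm using fun f hf => exists_pow_smul_eq_toTildeSections hUc (ι f hf) s
  -- The relations `f ^ n f • s = m f` suggest the linear map `f ^ n f ↦ m f` into `J`, which is
  -- well defined only up to `t`-power torsion; Artin-Rees removes it on a power of `(t)`.
  let N : Submodule R (R × J) := Submodule.span R ((fun f => (f ^ n f, m f)) '' t)
  have hN : ∀ x ∈ N, x.1 • s = toTildeSections J U x.2 :=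
    smul_eq_toTildeSections_of_mem_span (Set.forall_mem_image.2 hnm)
  have : Module.Finite R N := Module.Finite.span_of_finite R (t.finite_toSet.image _)
  obtain ⟨q, e, he⟩ := exists_linearMap_eq_on_pow_smul_of_ker_torsion
    (LinearMap.fst R R J ∘ₗ N.subtype) (LinearMap.snd R R J ∘ₗ N.subtype) (t := t) (by
      rintro f hf ⟨⟨x, y⟩, hxy⟩ (rfl : x = 0)
      have hy : toTildeSections J U y = 0 := by rw [← hN _ hxy, zero_smul]
      obtain ⟨k, hk⟩ := exists_pow_smul_eq_zero_of_toTildeSections_basicOpen_eq_zero (f := f)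
        (m := y) (by rw [← tilde_map_toTildeSections (ι f hf), hy, map_zero])
      exact ⟨k, Subtype.ext (Prod.ext (smul_zero _) hk)⟩)
  refine ⟨e 1, tilde_section_ext hU fun f hf i => ?_⟩
  have smul_e_one : (f ^ q * f ^ n f) • e 1 = f ^ q • m f := by
    rw [← map_smul, smul_eq_mul, mul_one]
    exact he (f ^ q • ⟨_, Submodule.subset_span ⟨f, hf, rfl⟩⟩)
      (Submodule.smul_mem_smul (Ideal.pow_mem_pow (Ideal.subset_span hf) q) trivial)
  refine (tilde_pow_smul_bijective f (q + n f)).injective ?_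
  rw [← Scheme.Modules.map_smul_Spec, ← Scheme.Modules.map_smul_Spec, ← map_smul, pow_add,
    smul_e_one, mul_smul, hnm f hf, map_smul]

lemma isFlasque_tildeAbFunctor_obj_of_injective [IsNoetherianRing R] (J : ModuleCat.{u} R)
    [Module.Injective R J] : TopCat.Sheaf.IsFlasque ((tildeAbFunctor R).obj J) where
  epi {U V} i := by
    refine (AddCommGrpCat.epi_iff_surjective _).2 fun s => ?_
    obtain ⟨j, rfl⟩ := toTildeSections_surjective_of_injective J V.unop s
    exact ⟨toTildeSections J U.unop j, tilde_map_toTildeSections i.unop j⟩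

end Tilde

section ExtPowerTorsion

universe v v' w w'

variable {R : Type*} [CommRing R] {D : Type w} [Category.{v} D] [Abelian D] [Linear R D]
  {C : Type w'} [Category.{v'} C] [Abelian C] [HasExt.{u} C] {G : D ⥤ C} {K : C} {a : R}

lemma exists_forall_comp_mk₀_eq_comp_extClass {S : ShortComplex C} (hS : S.ShortExact) {p : ℕ}
    (h : Subsingleton (Ext K S.X₂ (p + 1))) (x : Ext K S.X₁ (p + 1)) :
    ∃ y : Ext K S.X₃ p, ∀ φ : S ⟶ S, x.comp (Ext.mk₀ φ.τ₁) (add_zero (p + 1)) =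
      (y.comp (Ext.mk₀ φ.τ₃) (add_zero p)).comp hS.extClass rfl := by
  obtain ⟨y, rfl⟩ := Ext.covariant_sequence_exact₁ _ hS x (h.elim _ _) rfl
  refine ⟨y, fun φ => ?_⟩
  rw [Ext.comp_assoc (a₂₃ := 1) _ _ _ _ (by lia) (by lia), hS.extClass_naturality hS φ,
    ← Ext.comp_assoc (a₁₂ := p) _ _ _ (by lia) (by lia) (by lia)]

variable (G K a) in
/-- Every element of `Ext^p(K, G(M))` is killed by the endomorphism induced by some power of the
scalar `a`. -/
def IsExtPowerTorsion (M : D) (p : ℕ) : Prop :=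
  ∀ x : Ext K (G.obj M) p, ∃ k : ℕ, x.comp (Ext.mk₀ (G.map (a ^ k • 𝟙 M))) (add_zero p) = 0

lemma isExtPowerTorsion_zero_iff {M : D} :
    IsExtPowerTorsion G K a M 0 ↔
      ∀ φ : K ⟶ G.obj M, ∃ k : ℕ, φ ≫ G.map (a ^ k • 𝟙 M) = 0 := by
  simp only [IsExtPowerTorsion, (Ext.mk₀_bijective _ _).surjective.forall, Ext.mk₀_comp_mk₀,
    Ext.mk₀_eq_zero_iff]

namespace IsExtPowerTorsion

lemma subsingleton {M : D} {p : ℕ} (h : IsExtPowerTorsion G K a M p)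
    (ha : ∀ x : Ext K (G.obj M) p, x.comp (Ext.mk₀ (G.map (a • 𝟙 M))) (add_zero p) = 0 → x = 0) :
    Subsingleton (Ext K (G.obj M) p) := by
  refine subsingleton_of_forall_eq 0 fun x => ?_
  obtain ⟨k, hk⟩ := h x
  induction k with
  | zero => rwa [pow_zero, one_smul, G.map_id, Ext.comp_mk₀_id] at hk
  | succ k ih =>
    refine ih (ha _ ?_)
    rw [← hk, Ext.comp_assoc (a₂₃ := 0) _ _ _ _ (by lia) (by lia), Ext.mk₀_comp_mk₀,
      ← Functor.map_comp, Linear.smul_comp, Linear.comp_smul, Category.id_comp, smul_smul,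
      ← pow_succ]

variable [PreservesFiniteLimits G] [PreservesFiniteColimits G]

lemma succ {S : ShortComplex D} (hS : S.ShortExact) {p : ℕ}
    (h₂ : Subsingleton (Ext K (G.obj S.X₂) (p + 1))) (h₃ : IsExtPowerTorsion G K a S.X₃ p) :
    IsExtPowerTorsion G K a S.X₁ (p + 1) := by
  intro x
  obtain ⟨y, hy⟩ := exists_forall_comp_mk₀_eq_comp_extClass (hS.map_of_exact G) h₂ x
  obtain ⟨k, hk⟩ := h₃ y
  refine ⟨k, (hy (G.mapShortComplex.map
    { τ₁ := a ^ k • 𝟙 S.X₁, τ₂ := a ^ k • 𝟙 S.X₂, τ₃ := a ^ k • 𝟙 S.X₃ })).trans ?_⟩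
  exact (congr_arg (fun z => Ext.comp z _ _) hk).trans (Ext.zero_comp _ _ _ _ _)

lemma of_injective [EnoughInjectives D]
    (hG : ∀ (J : D) [Injective J] (p : ℕ), Subsingleton (Ext K (G.obj J) (p + 1)))
    (h : ∀ M : D, IsExtPowerTorsion G K a M 0) (M : D) (p : ℕ) : IsExtPowerTorsion G K a M p := by
  induction p generalizing M with
  | zero => exact h M
  | succ p ih =>
    let S := ShortComplex.mk (Injective.ι M) (cokernel.π (Injective.ι M)) (cokernel.condition _)
    have hS : S.ShortExact := { exact := ShortComplex.exact_cokernel _ }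
    exact succ hS (hG (Injective.under M) p) (ih S.X₃)

end IsExtPowerTorsion

end ExtPowerTorsion

section ExtQuotSMulTop

universe v w

variable {R : Type u} [CommRing R] {C : Type w} [Category.{v} C] [Abelian C] [HasExt.{u} C]
  {G : ModuleCat.{u} R ⥤ C} [PreservesFiniteLimits G] [PreservesFiniteColimits G]
  {K : C} {a : R} {M : ModuleCat.{u} R} (ha : IsSMulRegular M a)

include ha

lemma subsingleton_ext_zero_of_isSMulRegular (h : IsExtPowerTorsion G K a M 0) :
    Subsingleton (Ext K (G.obj M) 0) := by
  have := (ha.smulShortComplex_shortExact.map_of_exact G).mono_f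
  refine h.subsingleton fun x hx => ?_
  exact Ext.postcomp_mk₀_injective_of_mono _ ((M.smulShortComplex a).map G).f
    (hx.trans (map_zero ((Ext.mk₀ _).postcomp _ _)).symm)

lemma subsingleton_ext_succ_of_isSMulRegular {p : ℕ} (h : IsExtPowerTorsion G K a M (p + 1))
    (h' : Subsingleton (Ext K (G.obj (.of R (QuotSMulTop a M))) p)) :
    Subsingleton (Ext K (G.obj M) (p + 1)) := by
  refine h.subsingleton fun x hx => ?_
  obtain ⟨y, rfl⟩ := Ext.covariant_sequence_exact₁ _ (ha.smulShortComplex_shortExact.map_of_exact G)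
    x hx rfl
  obtain rfl : y = 0 := h'.elim y 0
  exact Ext.zero_comp _ _ _ _ _

lemma subsingleton_ext_quotSMulTop {p : ℕ} (h : Subsingleton (Ext K (G.obj M) p))
    (h' : Subsingleton (Ext K (G.obj M) (p + 1))) :
    Subsingleton (Ext K (G.obj (.of R (QuotSMulTop a M))) p) := by
  refine subsingleton_of_forall_eq 0 fun x => ?_
  obtain ⟨y, rfl⟩ := Ext.covariant_sequence_exact₃ _ (ha.smulShortComplex_shortExact.map_of_exact G)
    x rfl (h'.elim _ _)
  obtain rfl : y = 0 := h.elim y 0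
  exact Ext.zero_comp _ _ _ _ _

end ExtQuotSMulTop

section RegularSequence

open RingTheory.Sequence

variable {A : Type*} [CommRing A] {I : Ideal A} {M : Type*} [AddCommGroup M] [Module A M]

lemma isRegularSeqIn_nil : IsRegularSeqIn I M [] :=
  ⟨List.forall_mem_nil _, .nil A M⟩

lemma isRegularSeqIn_cons_iff {r : A} {rs : List A} :
    IsRegularSeqIn I M (r :: rs) ↔
      r ∈ I ∧ IsSMulRegular M r ∧ IsRegularSeqIn I (QuotSMulTop r M) rs := by
  simp only [IsRegularSeqIn, List.forall_mem_cons, isWeaklyRegular_cons_iff]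
  tauto

lemma exists_mem_isSMulRegular_of_annihilated_eq_zero [IsNoetherianRing A] [Module.Finite A M]
    (h : ∀ m : M, (∀ a ∈ I, a • m = 0) → m = 0) : ∃ a ∈ I, IsSMulRegular M a := by
  have : Subsingleton (A ⧸ I →ₗ[A] M) := by
    refine subsingleton_of_forall_eq 0 fun f => Submodule.linearMap_qext _ (LinearMap.ext_ring ?_)
    exact h _ fun a ha => by
      rw [← map_smul, smul_eq_mul, mul_one, LinearMap.comp_apply, Submodule.mkQ_apply,
        (Submodule.Quotient.mk_eq_zero I).2 ha, map_zero]
  obtain ⟨a, ha, haM⟩ := (IsSMulRegular.subsingleton_linearMap_iff (N := A ⧸ I)).1 this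
  rw [Ideal.annihilator_quotient] at ha
  exact ⟨a, ha, haM⟩

lemma IsRegularSeqIn.smul_top_lt_of_append_singleton (hIM : I • (⊤ : Submodule A M) ≠ ⊤)
    {rs : List A} {a : A} (h : IsRegularSeqIn I M (rs ++ [a])) :
    Ideal.ofList rs • (⊤ : Submodule A M) < Ideal.ofList (rs ++ [a]) • ⊤ := by
  have hrs : Ideal.ofList rs ≤ I := Ideal.span_le.2 fun b hb => h.1 b (List.mem_append_left _ hb)
  have hreg : IsSMulRegular (M ⧸ Ideal.ofList rs • (⊤ : Submodule A M)) a :=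
    (isWeaklyRegular_singleton_iff _ a).1 ((isWeaklyRegular_append_iff M rs [a]).1 h.2).2
  refine lt_of_le_not_ge (Submodule.smul_mono_left ?_) fun hle => hIM (top_unique fun m _ => ?_)
  · rw [Ideal.ofList_append]
    exact le_sup_left
  · have ham : a • m ∈ Ideal.ofList rs • (⊤ : Submodule A M) :=
      hle (Submodule.smul_mem_smul (Ideal.subset_span (by simp)) trivial)
    exact Submodule.smul_mono_left hrs (mem_of_isSMulRegular_quotient_of_smul_mem hreg ham)

lemma exists_isMaximalRegularSeqIn [IsNoetherian A M] (hIM : I • (⊤ : Submodule A M) ≠ ⊤) :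
    ∃ rs : List A, IsMaximalRegularSeqIn I M rs := by
  obtain ⟨_, ⟨rs, hrs, rfl⟩, hmax⟩ := set_has_maximal_iff_noetherian.2 ‹IsNoetherian A M›
    {N | ∃ rs, IsRegularSeqIn I M rs ∧ Ideal.ofList rs • ⊤ = N} ⟨_, [], isRegularSeqIn_nil, rfl⟩
  exact ⟨rs, hrs, fun a ha =>
    hmax _ ⟨_, ha, rfl⟩ (ha.smul_top_lt_of_append_singleton hIM)⟩

end RegularSequence

section RegularSequenceExt

universe v w

variable {R : Type u} [CommRing R] {C : Type w} [Category.{v} C] [Abelian C] [HasExt.{u} C]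
  {G : ModuleCat.{u} R ⥤ C} [PreservesFiniteLimits G] [PreservesFiniteColimits G] {K : C}
  {I : Ideal R} {rs : List R} {M : ModuleCat.{u} R}

lemma IsRegularSeqIn.subsingleton_ext (h : IsRegularSeqIn I M rs)
    (hI : ∀ a ∈ I, ∀ (N : ModuleCat.{u} R) (p : ℕ), IsExtPowerTorsion G K a N p)
    {p : ℕ} (hp : p < rs.length) : Subsingleton (Ext K (G.obj M) p) := by
  induction rs generalizing M p with
  | nil => exact absurd hp p.not_lt_zero
  | cons r rs ih =>
    obtain ⟨hr, hrM, hrs⟩ := isRegularSeqIn_cons_iff.1 h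
    cases p with
    | zero => exact subsingleton_ext_zero_of_isSMulRegular hrM (hI r hr M 0)
    | succ p =>
      exact subsingleton_ext_succ_of_isSMulRegular hrM (hI r hr M (p + 1))
        (ih hrs (Nat.lt_of_succ_lt_succ hp))

lemma IsRegularSeqIn.exists_append_of_subsingleton_ext [IsNoetherianRing R] [Module.Finite R M]
    (h : IsRegularSeqIn I M rs)
    (hI : ∀ N : ModuleCat.{u} R, Subsingleton (K ⟶ G.obj N) →
      ∀ m : N, (∀ a ∈ I, a • m = 0) → m = 0)
    (hM : ∀ p ≤ rs.length, Subsingleton (Ext K (G.obj M) p)) :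
    ∃ a, IsRegularSeqIn I M (rs ++ [a]) := by
  induction rs generalizing M with
  | nil =>
    obtain ⟨a, ha, haM⟩ := exists_mem_isSMulRegular_of_annihilated_eq_zero
      (hI M (Ext.homEquiv₀.subsingleton_congr.1 (hM 0 le_rfl)))
    exact ⟨a, isRegularSeqIn_cons_iff.2 ⟨ha, haM, isRegularSeqIn_nil⟩⟩
  | cons r rs ih =>
    obtain ⟨hr, hrM, hrs⟩ := isRegularSeqIn_cons_iff.1 h
    rw [List.length_cons] at hM
    have : Module.Finite R (ModuleCat.of R (QuotSMulTop r M)) :=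
      inferInstanceAs (Module.Finite R (QuotSMulTop r M))
    obtain ⟨a, ha⟩ := ih (M := .of R (QuotSMulTop r M)) hrs fun p hp =>
      subsingleton_ext_quotSMulTop hrM (hM p (by lia)) (hM (p + 1) (by lia))
    exact ⟨a, isRegularSeqIn_cons_iff.2 ⟨hr, hrM, ha⟩⟩

end RegularSequenceExt

section TildeSupport

open AlgebraicGeometry TopCat.Sheaf

variable {R : CommRingCat.{u}} {Z : Closeds (Spec R).toTopCat} {M : ModuleCat.{u} R}

lemma toTildeSections_mem_sectionsWithSupport_iff {m : M} :
    toTildeSections M ⊤ m ∈ sectionsWithSupport Z ((tildeAbFunctor R).obj M) ↔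
      toTildeSections M Z.compl m = 0 := by
  rw [← tilde_map_toTildeSections (homOfLE (le_top : Z.compl ≤ ⊤))]
  rfl

lemma isExtPowerTorsion_tildeAbFunctor_zero {a : R} (ha : specBasicOpen a ≤ Z.compl) :
    IsExtPowerTorsion (tildeAbFunctor R) (freeClosed Z) a M 0 := by
  refine isExtPowerTorsion_zero_iff.2 fun φ => ?_
  obtain ⟨⟨s, hsZ⟩, rfl⟩ := (freeClosed.homEquiv Z _).symm.surjective φ
  obtain ⟨m, rfl⟩ := toTildeSections_top_bijective.surjective s
  obtain ⟨k, hk⟩ := exists_pow_smul_eq_zero_of_toTildeSections_basicOpen_eq_zero (f := a) (m := m)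
    (by rw [← tilde_map_toTildeSections (homOfLE ha),
      toTildeSections_mem_sectionsWithSupport_iff.1 hsZ, map_zero])
  refine ⟨k, (freeClosed.homEquiv Z _).injective (Subtype.ext ?_)⟩
  rw [freeClosed.homEquiv_comp, AddEquiv.apply_symm_apply, map_zero]
  refine (tildeMap_app_toTildeSections (a ^ k • 𝟙 M) ⊤ m).trans ?_
  exact (congr_arg _ hk).trans (map_zero _)

lemma isExtPowerTorsion_tildeAbFunctor [IsNoetherianRing R] {a : R}
    (ha : specBasicOpen a ≤ Z.compl) (M : ModuleCat.{u} R) (p : ℕ) :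
    IsExtPowerTorsion (tildeAbFunctor R) (freeClosed Z) a M p := by
  refine .of_injective (fun J _ p => ?_) (fun _ => isExtPowerTorsion_tildeAbFunctor_zero ha) M p
  have : Module.Injective R J := (Module.injective_iff_injective_object R J).2 ‹_›
  have := isFlasque_tildeAbFunctor_obj_of_injective J
  exact freeClosed.subsingleton_ext_of_isFlasque p _

lemma eq_zero_of_annihilated_of_subsingleton_freeClosed_hom {I : Set R}
    (hI : Z.compl = ⨆ a ∈ I, specBasicOpen a)
    (h : Subsingleton (freeClosed Z ⟶ (tildeAbFunctor R).obj M)) (m : M)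
    (hm : ∀ a ∈ I, a • m = 0) : m = 0 := by
  have hmZ : toTildeSections M Z.compl m = 0 := tilde_section_ext hI fun a ha i => by
    rw [tilde_map_toTildeSections, map_zero]
    apply (tilde_pow_smul_bijective a 1).injective
    simp only [← map_smul, pow_one, hm a ha, map_zero, smul_zero]
  have eq_zero (s : sectionsWithSupport Z ((tildeAbFunctor R).obj M)) : s = 0 :=
    (freeClosed.homEquiv Z _).symm.injective (h.elim _ _)
  refine toTildeSections_top_bijective.injective (Eq.trans ?_ (map_zero _).symm)
  exact congr_arg Subtype.val (eq_zero ⟨_, toTildeSections_mem_sectionsWithSupport_iff.2 hmZ⟩)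

lemma IsRegularSeqIn.subsingleton_ext_tildeAbFunctor [IsNoetherianRing R] {I : Ideal R}
    {rs : List R} (h : IsRegularSeqIn I M rs)
    (hI : Z.compl = ⨆ a ∈ (I : Set R), specBasicOpen a) {p : ℕ} (hp : p < rs.length) :
    Subsingleton (Ext (freeClosed Z) ((tildeAbFunctor R).obj M) p) :=
  h.subsingleton_ext (fun _ ha =>
    isExtPowerTorsion_tildeAbFunctor (hI ▸ le_biSup (specBasicOpen (R := R)) ha)) hp

lemma IsRegularSeqIn.exists_append_of_subsingleton_ext_tildeAbFunctor [IsNoetherianRing R]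
    [Module.Finite R M] {I : Ideal R} {rs : List R} (h : IsRegularSeqIn I M rs)
    (hI : Z.compl = ⨆ a ∈ (I : Set R), specBasicOpen a)
    (hM : ∀ p ≤ rs.length, Subsingleton (Ext (freeClosed Z) ((tildeAbFunctor R).obj M) p)) :
    ∃ a, IsRegularSeqIn I M (rs ++ [a]) :=
  h.exists_append_of_subsingleton_ext
    (fun _ hN => eq_zero_of_annihilated_of_subsingleton_freeClosed_hom hI hN) hM

end TildeSupport

section SheafLocalCohomology

open AlgebraicGeometry TopCat.Sheaf

variable {A : Type u} [CommRing A] {I : Ideal A} {M : Type u} [AddCommGroup M] [Module A M]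

variable (I M) in
lemma isZero_sheafLocalCohomology_iff_subsingleton_ext (p : ℕ) :
    IsZero (sheafLocalCohomology I M p) ↔
      Subsingleton (Ext (freeClosed (closedZeroLocus I))
        ((tildeAbFunctor (.of A)).obj (.of A M)) p) :=
  isZero_cohomologyWithSupport_iff_subsingleton_ext (closedZeroLocus I) (tildeAbSheaf M) p

variable (I) in
lemma closedZeroLocus_compl_eq_iSup_specBasicOpen :
    (closedZeroLocus I).compl = ⨆ a ∈ (I : Set A), specBasicOpen (R := .of A) a :=
  eq_iSup_specBasicOpen_of_coe_eq_compl_zeroLocus rfl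

variable [IsNoetherianRing A]

lemma IsRegularSeqIn.isZero_sheafLocalCohomology {rs : List A} (h : IsRegularSeqIn I M rs) {p : ℕ}
    (hp : p < rs.length) : IsZero (sheafLocalCohomology I M p) :=
  (isZero_sheafLocalCohomology_iff_subsingleton_ext I M p).2
    (IsRegularSeqIn.subsingleton_ext_tildeAbFunctor (R := .of A) (M := .of A M) h
      (closedZeroLocus_compl_eq_iSup_specBasicOpen I) hp)

variable [Module.Finite A M]

lemma IsRegularSeqIn.exists_append_of_isZero_sheafLocalCohomology {rs : List A}
    (h : IsRegularSeqIn I M rs) (hM : ∀ p ≤ rs.length, IsZero (sheafLocalCohomology I M p)) :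
    ∃ a, IsRegularSeqIn I M (rs ++ [a]) := by
  have : Module.Finite (CommRingCat.of A) (ModuleCat.of A M) := ‹_›
  exact IsRegularSeqIn.exists_append_of_subsingleton_ext_tildeAbFunctor (R := .of A) h
    (closedZeroLocus_compl_eq_iSup_specBasicOpen I)
    fun p hp => (isZero_sheafLocalCohomology_iff_subsingleton_ext I M p).1 (hM p hp)

lemma IsMaximalRegularSeqIn.length_eq_depth {rs : List A} (h : IsMaximalRegularSeqIn I M rs) :
    (rs.length : ℕ∞) = depth I M := by
  refine le_antisymm (le_iSup₂_of_le rs h.1 le_rfl) (iSup₂_le fun rs' h' => Nat.cast_le.2 ?_)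
  by_contra! hlt
  obtain ⟨a, ha⟩ := h.1.exists_append_of_isZero_sheafLocalCohomology fun p hp =>
    h'.isZero_sheafLocalCohomology (hp.trans_lt hlt)
  exact h.2 a ha

lemma exists_isRegularSeqIn_length_eq {n : ℕ}
    (h : ∀ p < n, IsZero (sheafLocalCohomology I M p)) :
    ∃ rs : List A, IsRegularSeqIn I M rs ∧ rs.length = n := by
  induction n with
  | zero => exact ⟨[], isRegularSeqIn_nil, rfl⟩
  | succ n ih =>
    obtain ⟨rs, hrs, rfl⟩ := ih fun p hp => h p (hp.trans n.lt_succ_self)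
    obtain ⟨a, ha⟩ := hrs.exists_append_of_isZero_sheafLocalCohomology fun p hp =>
      h p (Nat.lt_succ_of_le hp)
    exact ⟨_, ha, List.length_append⟩

variable (I M) in
lemma le_depth_iff_forall_isZero_sheafLocalCohomology (n : ℕ) :
    (n : ℕ∞) ≤ depth I M ↔ ∀ p < n, IsZero (sheafLocalCohomology I M p) := by
  refine ⟨fun hn p hp => ?_, fun h => ?_⟩
  · obtain ⟨rs, hlt⟩ := lt_iSup_iff.1 ((Nat.cast_lt.2 hp).trans_le hn)
    obtain ⟨hrs, hlt⟩ := lt_iSup_iff.1 hlt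
    exact hrs.isZero_sheafLocalCohomology (Nat.cast_lt.1 hlt)
  · obtain ⟨rs, hrs, rfl⟩ := exists_isRegularSeqIn_length_eq h
    exact le_iSup₂_of_le rs hrs le_rfl

end SheafLocalCohomology

end

theorem mainTheorem11 {A : Type u} [CommRing A] [IsNoetherianRing A]
    {M : Type u} [AddCommGroup M] [Module A M] [Module.Finite A M]
    (I : Ideal A) (hIM : I • (⊤ : Submodule A M) ≠ ⊤) :
    ((∃ rs : List A, IsMaximalRegularSeqIn I M rs) ∧
      ∀ rs : List A, IsMaximalRegularSeqIn I M rs → (rs.length : ℕ∞) = depth I M) ∧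
    ∀ n : ℕ, (n : ℕ∞) ≤ depth I M ↔
      ∀ p : ℕ, p < n → Limits.IsZero (sheafLocalCohomology I M p) := by
  exact ⟨⟨exists_isMaximalRegularSeqIn hIM, fun _ h => h.length_eq_depth⟩,
    le_depth_iff_forall_isZero_sheafLocalCohomology I M⟩
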